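/- Let $\Gamma=(X,f)$ be an autonomous system $\dot x=f(x)$ on an open set $X\subseteq\mathbb{R}^n$, with $f$ locally Lipschitz and of linear growth. A slice-family is given by nested open positive invariant sets $A_0\subsetneq A_1\subsetneq\dots\subsetneq A_m$; its slices are the closures in $X$ of $A_j\setminus A_{j-1}$, $j=1,\dots,m$. A partitioning function for it is a continuous $\psi:X\to\mathbb{R}$ with values $-\infty\le a_0<a_1<\dots<a_m\le\infty$ such that the $j$-th slice is $\psi^{-1}([a_{j-1},a_j])$ and every finite $a_j$ is a regular value of $\psi$ (that is, at each point of $\psi^{-1}(a_j)$ the function $\psi$ is $C^1$ with nonzero derivative). Let $\mathcal{S}=\{\mathcal{S}_1,\dots,\mathcal{S}_k\}$ be a collection of $k$ slice-families with partitioning functions $\psi_1,\dots,\psi_k$, whose slices intersect transversally: for every choice $S_{(1,g_1)},\dots,S_{(k,g_k)}$ of one slice per family, the boundaries in $X$ satisfy $((\mathrm{bd}\,S_{(1,g_1)}\pitchfork \mathrm{bd}\,S_{(2,g_2)})\pitchfork\cdots)\pitchfork \mathrm{bd}\,S_{(k,g_k)}$. An extended cell is a nonempty intersection $\bigcap_{i=1}^k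 S_{(i,g_i)}$, and the cells of $\mathcal{S}$ are the connected components of the extended cells. Assume that there are finitely many cells, and let $\mathcal{A}(\mathcal{S})$ be the timed automaton generated by $\mathcal{S}$; its locations are the cells. Call $\mathcal{A}(\mathcal{S})$ refinable if for every $\varepsilon>0$ there is a collection $\mathcal{S}'$ of the same kind, also with $k$ slice-families and finitely many cells, which refines $\mathcal{S}$ (it has the same partitioning functions, each slice of $\mathcal{S}'_i$ lies in a slice of $\mathcal{S}_i$, and the slices of $\mathcal{S}'_i$ and those of $\mathcal{S}_i$ have the same union) and each of whose cells lies in some ball of radius $\varepsilon$. Suppose that for at least one choice $g$ the transversal intersection of boundaries $\mathrm{bd}\,S_{(1,g_1)}\pitchfork\cdots\pitchfork \mathrm{bd}\,S_{(k,g_k)}$ is nonempty. If $\mathcal{A}(\mathcal{S})$ is a refinable abstraction of $\Gamma$, then $k=n$, i.e. $\mathcal{S}$ consists of exactly $n$ slice-families. -/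

import Mathlib

open Set

/-- The ambient Euclidean space `ℝⁿ`. -/
abbrev State (n : ℕ) : Type := EuclideanSpace ℝ (Fin n)

/-- An autonomous system `ẋ = f(x)` on an open state space `X ⊆ ℝⁿ`, with `f` locally Lipschitz
and of linear growth on `X`. -/
structure DynSystem (n : ℕ) where
  X : Set (State n)
  isOpen_X : IsOpen X
  f : State n → State n
  locallyLipschitz : LocallyLipschitzOn X f
  linearGrowth : ∃ c : ℝ, ∀ x ∈ X, ‖f x‖ ≤ c * (1 + ‖x‖)

namespace DynSystem

variable {n : ℕ}

/-- `γ` is a solution of `ẋ = f(x)` in `X` on the time interval `[0, T]`. -/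
def IsSolution (Γ : DynSystem n) (T : ℝ) (γ : ℝ → State n) : Prop :=
  ∀ t ∈ Icc 0 T, γ t ∈ Γ.X ∧ HasDerivWithinAt γ (Γ.f (γ t)) (Icc 0 T) t

/-- `A ⊆ X` is positive invariant: solutions starting in `A` stay in `A`. -/
def PositiveInvariant (Γ : DynSystem n) (A : Set (State n)) : Prop :=
  A ⊆ Γ.X ∧ ∀ T : ℝ, 0 ≤ T → ∀ γ : ℝ → State n, Γ.IsSolution T γ → γ 0 ∈ A → γ T ∈ A

end DynSystem

/-- The nested sets `A₀ ⊊ A₁ ⊊ ⋯ ⊊ A_m` generating a slice-family: they are open and positive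
invariant. -/
structure SliceFamily {n : ℕ} (Γ : DynSystem n) where
  /-- the number of slices -/
  m : ℕ
  A : Fin (m + 1) → Set (State n)
  isOpen_A : ∀ j, IsOpen (A j)
  strictMono_A : StrictMono A
  positiveInvariant_A : ∀ j, Γ.PositiveInvariant (A j)

namespace SliceFamily

variable {n : ℕ} {Γ : DynSystem n}

/-- The slices are the set-differences of consecutive sets, closed up in `X`. They are numbered
`0, …, m - 1`; slice `j` lies between `A_j` and `A_{j+1}`. -/
def slice (F : SliceFamily Γ) (j : Fin F.m) : Set (State n) :=
  closure (F.A j.succ \ F.A j.castSucc) ∩ Γ.X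

/-- `ψ` is a partitioning function for the slice-family, with boundary values
`a₀ < a₁ < ⋯ < a_m` in `[-∞, ∞]`: the slices are the sets `ψ⁻¹([a_j, a_{j+1}])`, and every (finite)
`a_j` is a regular value of `ψ` on `X`. -/
structure IsPartitioningFunction (F : SliceFamily Γ) (ψ : State n → ℝ)
    (a : Fin (F.m + 1) → EReal) : Prop where
  continuousOn : ContinuousOn ψ Γ.X
  strictMono_a : StrictMono a
  slice_eq : ∀ j : Fin F.m,
    F.slice j = {x | x ∈ Γ.X ∧ a j.castSucc ≤ (ψ x : EReal) ∧ (ψ x : EReal) ≤ a j.succ}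
  regular : ∀ j, ∀ x ∈ Γ.X, (ψ x : EReal) = a j → ContDiffAt ℝ 1 ψ x ∧ fderiv ℝ ψ x ≠ 0

end SliceFamily

/-- `k` slice-families with partitioning functions, whose slices intersect transversally. -/
structure SliceCollection {n : ℕ} (Γ : DynSystem n) (k : ℕ) where
  family : Fin k → SliceFamily Γ
  ψ : Fin k → State n → ℝ
  a : (i : Fin k) → Fin ((family i).m + 1) → EReal
  partitioning : ∀ i, (family i).IsPartitioningFunction (ψ i) (a i)
  /-- For every choice `g` of one slice per family, the boundaries of the chosen slices are
  successively transversal, `((bd S₁ ⋔ bd S₂) ⋔ bd S₃) ⋔ ⋯`: at each common point of the first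
  `i` boundaries, the tangent space of the intersection of the earlier boundaries and the tangent
  space of the last one span `ℝⁿ`. (The boundary in `X` of a slice consists of regular level sets
  of `ψ i`, so its tangent space at `x` is the kernel of the derivative.) -/
  transversal : ∀ g : (i : Fin k) → Fin (family i).m, ∀ i : Fin k, ∀ x ∈ Γ.X,
    (∀ j ≤ i, x ∈ frontier ((family j).slice (g j))) →
      (⨅ j : Fin k, ⨅ _ : j < i, LinearMap.ker (fderiv ℝ (ψ j) x).toLinearMap) ⊔
        LinearMap.ker (fderiv ℝ (ψ i) x).toLinearMap = ⊤

namespace SliceCollection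

variable {n : ℕ} {Γ : DynSystem n} {k : ℕ}

/-- A choice `g` of one slice in each slice-family. -/
abbrev Index (S : SliceCollection Γ k) : Type := (i : Fin k) → Fin (S.family i).m

/-- The extended cell with index `g`, the intersection of the chosen slices. -/
def extendedCell (S : SliceCollection Γ k) (g : S.Index) : Set (State n) :=
  {x | x ∈ Γ.X ∧ ∀ i, x ∈ (S.family i).slice (g i)}

/-- The partition `K(S)`: a cell is a connected component of a nonempty extended cell, recorded
together with the index of that extended cell. -/
def Cell (S : SliceCollection Γ k) : Type :=
  {e : S.Index × Set (State n) //
    ∃ x ∈ S.extendedCell e.1, e.2 = connectedComponentIn (S.extendedCell e.1) x}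

/-- The index of the extended cell that contains a cell. -/
def Cell.index {S : SliceCollection Γ k} (e : S.Cell) : S.Index := e.1.1

/-- The cell as a set of states. -/
def Cell.carrier {S : SliceCollection Γ k} (e : S.Cell) : Set (State n) := e.1.2

/-- The (transversal) intersection in `X` of the boundaries of the slices chosen by `g`. -/
def boundaryIntersection (S : SliceCollection Γ k) (g : S.Index) : Set (State n) :=
  {x | x ∈ Γ.X ∧ ∀ i, x ∈ frontier ((S.family i).slice (g i))}

/-- `S'` refines `S`: the partitioning functions are the same, every slice of `S'` lies in a slice
of the corresponding family of `S`, and corresponding families cover the same set. -/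
def Refines (S' S : SliceCollection Γ k) : Prop :=
  ∀ i, S'.ψ i = S.ψ i ∧
    (∀ j', ∃ j, (S'.family i).slice j' ⊆ (S.family i).slice j) ∧
    ⋃ j', (S'.family i).slice j' = ⋃ j, (S.family i).slice j

end SliceCollection

/-- The relations that may occur in clock constraints. -/
inductive ClockRel : Type
  | le | lt | eq | gt | ge

/-- Clock constraints over the set `C` of clocks. Constants are extended reals, so that an
unbounded sojourn time is allowed. -/
inductive ClockConstraint (C : Type) : Type
  | single (c : C) (r : ClockRel) (b : EReal)
  | diff (c₁ c₂ : C) (r : ClockRel) (b : EReal)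
  | conj (p q : ClockConstraint C)
  | true

/-- The conjunction of a finite list of clock constraints. -/
def ClockConstraint.all {C : Type} (l : List (ClockConstraint C)) : ClockConstraint C :=
  l.foldr ClockConstraint.conj ClockConstraint.true

/-- A timed automaton `(L, L₀, C, Σ, I, Δ)`; `Act` is the input alphabet `Σ`. -/
structure TimedAutomaton (C Act : Type) where
  Loc : Type
  finite_Loc : Finite Loc
  init : Set Loc
  inv : Loc → ClockConstraint C
  trans : Set (Loc × ClockConstraint C × Act × Set C × Loc)
  finite_trans : trans.Finite

/-- The data from which the timed automaton `A(S)` of a system is generated: a collection of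
`k` slice-families with finitely many cells, lower and upper bounds for the time spent in each
slice, and a set of initial cells. -/
structure Abstraction {n : ℕ} (Γ : DynSystem n) (k : ℕ) where
  S : SliceCollection Γ k
  finite_Cell : Finite S.Cell
  tLow : (i : Fin k) → Fin (S.family i).m → EReal
  tHigh : (i : Fin k) → Fin (S.family i).m → EReal
  init : Set S.Cell

namespace Abstraction

variable {n : ℕ} {Γ : DynSystem n} {k : ℕ}

/-- There is a transition labelled `σ_i` from cell `e` to cell `e'` if the cells touch and `e'`
belongs to the slices of `e`, except that its slice in family `i` is the next lower one. -/
def Crosses (A : Abstraction Γ k) (i : Fin k) (e e' : A.S.Cell) : Prop :=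
  (e.carrier ∩ e'.carrier).Nonempty ∧ (e'.index i : ℕ) + 1 = e.index i ∧
    ∀ j, j ≠ i → e'.index j = e.index j

/-- The transition labelled `σ_i` from `e` to `e'`: its guard bounds the `i`-th clock from below by
the minimal time spent in the slice that is left, and it resets the `i`-th clock. -/
def edge (A : Abstraction Γ k) (p : A.S.Cell × Fin k × A.S.Cell) :
    A.S.Cell × ClockConstraint (Fin k) × Fin k × Set (Fin k) × A.S.Cell :=
  (p.1, .single p.2.1 .ge (A.tLow p.2.1 (p.1.index p.2.1)), p.2.1, {p.2.1}, p.2.2)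

/-- The timed automaton `A(S)`: its locations are the cells, there is one clock and one symbol for
each slice-family, and the invariant of a cell bounds the `i`-th clock by the maximal time spent in
its `i`-th slice. -/
def automaton (A : Abstraction Γ k) : TimedAutomaton (Fin k) (Fin k) where
  Loc := A.S.Cell
  finite_Loc := A.finite_Cell
  init := A.init
  inv e := .all (List.ofFn fun i : Fin k => .single i .le (A.tHigh i (e.index i)))
  trans := A.edge '' {p | A.Crosses p.2.1 p.1 p.2.2}
  finite_trans := by
    have := A.finite_Cell
    exact (Set.toFinite _).image _

/-- The set of states abstracted by a location of `A(S)`. -/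
def concretize (A : Abstraction Γ k) (l : A.automaton.Loc) : Set (State n) :=
  SliceCollection.Cell.carrier (S := A.S) l

/-- The abstraction is refinable: its cells can be made arbitrarily small by refining the
slice-families, that is, for every `ε > 0` there is an abstraction over refined slice-families all
of whose locations abstract sets contained in balls of radius `ε`. -/
def IsRefinable (A : Abstraction Γ k) : Prop :=
  ∀ ε : ℝ, 0 < ε → ∃ A' : Abstraction Γ k, A'.S.Refines A.S ∧
    ∀ l : A'.automaton.Loc, ∃ c : State n, A'.concretize l ⊆ Metric.ball c ε

end Abstraction

/-! At a common boundary point `x` every `ψ i` takes a boundary value, so it is regular there, and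
successive transversality makes the `k` differentials linearly independent; hence `k ≤ n`. If `k <
n`, the implicit function theorem puts a nontrivial connected set `s` through `x` inside the common
level set of all the `ψ i`. A refinement keeps the `ψ i`, and its slices are still preimages of
intervals, so it can never cut `s`: some cell always contains all of `s`, and cells cannot become
arbitrarily small. -/

theorem surjective_pi_of_transversal {k : ℕ} {E : Type*} [AddCommGroup E] [Module ℝ E]
    (φ : Fin k → E →ₗ[ℝ] ℝ) (hne : ∀ i, φ i ≠ 0)
    (htr : ∀ i, (⨅ j : Fin k, ⨅ _ : j < i, LinearMap.ker (φ j)) ⊔ LinearMap.ker (φ i) = ⊤) :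
    Function.Surjective (LinearMap.pi φ) := by
  -- Otherwise the intersection of the earlier kernels would lie in `ker (φ i)`, and transversality
  -- would force `φ i = 0`.
  have hv : ∀ i, ∃ v, (∀ j < i, φ j v = 0) ∧ φ i v ≠ 0 := by
    intro i
    by_contra! h
    refine hne i (LinearMap.ker_eq_top.1 (top_le_iff.1 ?_))
    rw [← htr i]
    refine sup_le (fun v hv => h v fun j hj => ?_) le_rfl
    simpa using (Submodule.mem_iInf _).1 ((Submodule.mem_iInf _).1 hv j) hj
  rw [← LinearMap.range_eq_top]
  by_contra hlt
  -- A functional `c` vanishing on a proper range is a linear relation among the `φ i`, with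
  -- coefficients `c (Pi.single i 1)`.
  obtain ⟨c, hc, hle⟩ := Submodule.exists_le_ker_of_lt_top _ (lt_top_iff_ne_top.2 hlt)
  have hsum : ∀ v, ∑ i, φ i v * c (Pi.single i 1) = 0 := by
    intro v
    have h : c (LinearMap.pi φ v) = 0 := hle ⟨v, rfl⟩
    rw [LinearMap.pi_apply_eq_sum_univ c] at h
    refine (Finset.sum_congr rfl fun i _ => ?_).trans h
    congr 2
    ext j
    simp [Pi.single_apply, eq_comm]
  refine hc (LinearMap.pi_ext' fun i => LinearMap.ext_ring ?_)
  change c (Pi.single i 1) = 0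
  -- Descending induction: in the relation at the vector `v` of `hv i`, terms before `i` vanish by
  -- choice of `v`, terms after `i` by the induction hypothesis.
  induction i using WellFoundedGT.induction with
  | ind i ih =>
    obtain ⟨v, hlt, hi⟩ := hv i
    have h := hsum v
    rw [Finset.sum_eq_single i] at h
    · exact (mul_eq_zero.1 h).resolve_left hi
    · intro j _ hj
      rcases lt_or_gt_of_ne hj with hj | hj
      · simp [hlt j hj]
      · simp [ih j hj]
    · simp

/-- A level set through a regular point contains a connected set with more than one point, if the
derivative there has a nonzero kernel. -/
theorem HasStrictFDerivAt.exists_isPreconnected_level {E F : Type*}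
    [NormedAddCommGroup E] [NormedSpace ℝ E] [CompleteSpace E]
    [NormedAddCommGroup F] [NormedSpace ℝ F] [FiniteDimensional ℝ F]
    {f : E → F} {f' : E →L[ℝ] F} {x : E} (hf : HasStrictFDerivAt f f' x)
    (hsurj : f'.range = ⊤) (hker : f'.ker ≠ ⊥) {U : Set E} (hU : U ∈ nhds x) :
    ∃ s ⊆ U, IsPreconnected s ∧ x ∈ s ∧ (∀ y ∈ s, f y = f x) ∧ ∃ y ∈ s, y ≠ x := by
  -- In the chart `e` the level set of `f` through `x` is the slice with first coordinate `f x`; a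
  -- small ball in the kernel is pulled back from it.
  set e := hf.implicitToOpenPartialHomeomorph f f' hsurj
  have hx : x ∈ e.source := hf.mem_implicitToOpenPartialHomeomorph_source hsurj
  have hex : e x = (f x, 0) := hf.implicitToOpenPartialHomeomorph_self hsurj
  have hfst : ∀ y, (e y).1 = f y := fun y => hf.implicitToOpenPartialHomeomorph_fst hsurj y
  have hV : e.symm ⁻¹' U ∩ e.target ∈ nhds (f x, (0 : f'.ker)) := by
    rw [← hex]
    refine Filter.inter_mem ?_ (e.open_target.mem_nhds (e.map_source hx))
    exact (e.continuousAt_symm (e.map_source hx)).preimage_mem_nhds (by rwa [e.left_inv hx])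
  have hcont : Continuous fun w : f'.ker => (f x, w) := by fun_prop
  obtain ⟨r, hr, hball⟩ := Metric.mem_nhds_iff.1 (hcont.continuousAt.preimage_mem_nhds hV)
  have htgt : ∀ w ∈ Metric.ball (0 : f'.ker) r, (f x, w) ∈ e.target := fun w hw => (hball hw).2
  refine ⟨(fun w => e.symm (f x, w)) '' Metric.ball 0 r, ?_, ?_, ?_, ?_, ?_⟩
  · rintro _ ⟨w, hw, rfl⟩
    exact (hball hw).1
  · refine (convex_ball _ _).isPreconnected.image _ ?_
    exact e.continuousOn_symm.comp hcont.continuousOn htgt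
  · exact ⟨0, Metric.mem_ball_self hr, (congrArg e.symm hex.symm).trans (e.left_inv hx)⟩
  · rintro _ ⟨w, hw, rfl⟩
    rw [← hfst, e.right_inv (htgt w hw)]
  · have : Nontrivial f'.ker := Submodule.nontrivial_iff_ne_bot.2 hker
    obtain ⟨w, hw0⟩ := exists_ne (0 : f'.ker)
    obtain ⟨t, ht, htr⟩ : ∃ t : ℝ, t ≠ 0 ∧ t • w ∈ Metric.ball (0 : f'.ker) r := by
      refine ⟨r / 2 / ‖w‖, by positivity, ?_⟩
      have : ‖w‖ ≠ 0 := norm_ne_zero_iff.2 hw0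
      rw [mem_ball_zero_iff, norm_smul, Real.norm_of_nonneg (by positivity)]
      field_simp
      linarith
    refine ⟨_, ⟨t • w, htr, rfl⟩, fun h => smul_ne_zero ht hw0 ?_⟩
    have h2 := congrArg e h
    rw [e.right_inv (htgt _ htr), hex] at h2
    exact (Prod.ext_iff.1 h2).2

namespace SliceFamily

variable {n : ℕ} {Γ : DynSystem n} {F : SliceFamily Γ} {ψ : State n → ℝ}
  {a : Fin (F.m + 1) → EReal}

theorem mem_slice_of_mem_frontier {j : Fin F.m} {x : State n} (hxX : x ∈ Γ.X)
    (hx : x ∈ frontier (F.slice j)) : x ∈ F.slice j :=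
  ⟨closure_minimal inter_subset_left isClosed_closure (frontier_subset_closure hx), hxX⟩

/-- If `ψ x` avoids every boundary value, both inequalities defining the slice are strict and
persist near `x` by continuity, so `x` is interior. -/
theorem IsPartitioningFunction.exists_eq_of_mem_frontier (h : F.IsPartitioningFunction ψ a)
    {j : Fin F.m} {x : State n} (hxX : x ∈ Γ.X) (hx : x ∈ frontier (F.slice j)) :
    ∃ i, (ψ x : EReal) = a i := by
  by_contra! hne
  have hmem := mem_slice_of_mem_frontier hxX hx
  rw [h.slice_eq] at hmem
  have hlo := lt_of_le_of_ne hmem.2.1 (hne _).symm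
  have hhi := lt_of_le_of_ne hmem.2.2 (hne _)
  have hX := Γ.isOpen_X.mem_nhds hxX
  have hc : ContinuousAt (fun y => (ψ y : EReal)) x :=
    continuous_coe_real_ereal.continuousAt.comp (h.continuousOn.continuousAt hX)
  refine hx.2 (mem_interior_iff_mem_nhds.2 ?_)
  rw [h.slice_eq]
  filter_upwards [hX, hc.eventually_const_lt hlo, hc.eventually_lt_const hhi] with y h₁ h₂ h₃
  exact ⟨h₁, h₂.le, h₃.le⟩

end SliceFamily

namespace SliceCollection

variable {n k : ℕ} {Γ : DynSystem n} {S : SliceCollection Γ k} {g : S.Index} {x : State n}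

theorem regular_of_mem_boundaryIntersection (hx : x ∈ S.boundaryIntersection g) (i : Fin k) :
    ContDiffAt ℝ 1 (S.ψ i) x ∧ fderiv ℝ (S.ψ i) x ≠ 0 := by
  obtain ⟨j, hj⟩ := (S.partitioning i).exists_eq_of_mem_frontier hx.1 (hx.2 i)
  exact (S.partitioning i).regular j x hx.1 hj

theorem surjective_fderiv_of_mem_boundaryIntersection (hx : x ∈ S.boundaryIntersection g) :
    Function.Surjective (ContinuousLinearMap.pi fun i => fderiv ℝ (S.ψ i) x) :=
  surjective_pi_of_transversal (fun i => (fderiv ℝ (S.ψ i) x).toLinearMap)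
    (fun i h => (regular_of_mem_boundaryIntersection hx i).2
      (ContinuousLinearMap.coe_injective h))
    (fun i => S.transversal g i x hx.1 fun j _ => hx.2 j)

theorem hasStrictFDerivAt_of_mem_boundaryIntersection (hx : x ∈ S.boundaryIntersection g) :
    HasStrictFDerivAt (fun y i => S.ψ i y)
      (ContinuousLinearMap.pi fun i => fderiv ℝ (S.ψ i) x) x :=
  hasStrictFDerivAt_pi.2 fun i =>
    (regular_of_mem_boundaryIntersection hx i).1.hasStrictFDerivAt one_ne_zero

/-- A connected subset of a common level set of the partitioning functions lies in a single cell. -/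
theorem exists_cell_superset {s : Set (State n)} (hsX : s ⊆ Γ.X) (hs : IsPreconnected s)
    (hxs : x ∈ s) (hlevel : ∀ y ∈ s, ∀ i, S.ψ i y = S.ψ i x)
    (hx : ∀ i, x ∈ ⋃ j, (S.family i).slice j) : ∃ e : S.Cell, s ⊆ e.carrier := by
  choose g hg using fun i => mem_iUnion.1 (hx i)
  have hsub : s ⊆ S.extendedCell g := by
    refine fun y hy => ⟨hsX hy, fun i => ?_⟩
    have h := hg i
    -- Within `Γ.X`, membership in a slice depends only on the value of `ψ i`.
    rw [(S.partitioning i).slice_eq] at h ⊢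
    exact ⟨hsX hy, by simpa only [hlevel y hy i] using h.2⟩
  exact ⟨⟨(g, connectedComponentIn (S.extendedCell g) x), x, hsub hxs, rfl⟩,
    hs.subset_connectedComponentIn hxs hsub⟩

end SliceCollection

theorem proposition9 {n k : ℕ} (Γ : DynSystem n) (A : Abstraction Γ k)
    (hmeet : ∃ g : A.S.Index, (A.S.boundaryIntersection g).Nonempty)
    (href : A.IsRefinable) :
    k = n := by
  obtain ⟨g, x, hx⟩ := hmeet
  have hsurj := SliceCollection.surjective_fderiv_of_mem_boundaryIntersection hx
  have hrank := LinearMap.finrank_range_add_finrank_ker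
    (ContinuousLinearMap.pi fun i => fderiv ℝ (A.S.ψ i) x).toLinearMap
  have hrange := LinearMap.range_eq_top.2 hsurj
  rw [hrange, finrank_top, Module.finrank_fin_fun, finrank_euclideanSpace_fin] at hrank
  -- Rank-nullity, `k + dim ker = n`, gives `k ≤ n`, and a nonzero kernel when `k < n`.
  refine le_antisymm (by omega) (not_lt.1 fun hkn => ?_)
  obtain ⟨s, hsX, hs, hxs, hlevel, y, hys, hyx⟩ :=
    (SliceCollection.hasStrictFDerivAt_of_mem_boundaryIntersection hx).exists_isPreconnected_level
      hrange (fun h => by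
        have h0 := (congrArg (fun V : Submodule ℝ (State n) => Module.finrank ℝ V) h).trans
          (finrank_bot ℝ (State n))
        exact absurd (hrank.symm.trans (congrArg (k + ·) h0)) hkn.ne')
      (Γ.isOpen_X.mem_nhds hx.1)
  -- An open ball of this radius cannot contain both `x` and `y`.
  obtain ⟨A', hA', hsmall⟩ := href (dist y x / 2) (half_pos (dist_pos.2 hyx))
  obtain ⟨e, he⟩ := SliceCollection.exists_cell_superset (S := A'.S) hsX hs hxs
    (fun z hz i => by rw [(hA' i).1]; exact congrFun (hlevel z hz) i)
    -- Equality of the unions keeps `x` covered by the refined slices of each family.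
    (fun i => by
      rw [(hA' i).2.2]
      exact mem_iUnion.2 ⟨g i, SliceFamily.mem_slice_of_mem_frontier hx.1 (hx.2 i)⟩)
  obtain ⟨c, hc⟩ := hsmall e
  have h₁ := Metric.mem_ball.1 (hc (he hys))
  have h₂ := Metric.mem_ball.1 (hc (he hxs))
  linarith [dist_triangle_right y x c]
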